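/- Let $p$ be a prime, $f\ge 1$, $q=p^f$, and suppose that $n:=q+1=2^sr^t>3$ for an odd prime $r$ and integers $s,t\ge 0$, where $s\ge 2$ or $q$ is even. Let $X$ be a finite almost simple group with socle $T$ such that $|X:T|\le 2$, and let $R\le X$ be a subgroup isomorphic to the affine group $\mathrm{AGL}_1(q)$, written as $R=F{:}(\langle b\rangle\times\langle c\rangle)$, where $F\cong\mathbb Z_p^f$, $b$ has order $\frac{q-1}{\gcd(2,q-1)}$ and $c$ has order $\gcd(2,q-1)$. Let $\tau=(1,2,\dots,n)$ and let $W=X\wr\langle\tau\rangle=X^n{:}\langle\tau\rangle$ be the wreath product, in which $(x_1,x_2,\dots,x_n)^\tau=\tau^{-1}(x_1,x_2,\dots,x_n)\tau=(x_n,x_1,\dots,x_{n-1})$ for $x_i\in X$. For $1\le i\le n$ let $\pi_i:X^n\to X$ be the projection to the $i$-th coordinate. For $Y\le X$ regard $Y^n$ as a subgroup of $X^n\le W$. Put $\theta=(bc,b,bc,\dots,bc)\,\tau\in W$, where the first factor has $b$ as its second coordinate and $bc$ as every other coordinate. Let $E\le F^n$ be a minimal normal subgroup of $F^n{:}\langle\theta\rangle$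 such that (1) $E\cong\mathbb Z_p^{2f}$; (2) $\langle\theta\rangle$ acts transitively on $E\setminus\{1\}$ by conjugation; (3) $\pi_i(E)=F$ for all $i$, and $\ker(\pi_i)\cap E\ne\ker(\pi_j)\cap E$ for $1\le i<j\le n$. Let $G=T^n\langle\theta\rangle$ and $H=E\langle\theta\rangle$. Then $H\le G$, $H=E{:}\langle\theta\rangle$ with $E\cap\langle\theta\rangle=1$, and $H\cong\mathrm{AGL}_1(q^2)$. The group $G$ has $T^n$ as its unique minimal normal subgroup, and $G$ acts on the set $[G:H]$ of cosets of $H$ in $G$ as a quasiprimitive permutation group of non-diagonal PA type. Moreover $T^n\cap H$ is a subdirect product of $(R\cap T)^n$, that is, $\pi_i(T^n\cap H)=R\cap T$ for all $i$. Here a permutation group is quasiprimitive if it is transitive and each of its nontrivial normal subgroups is transitive. A quasiprimitive group $G$ on a set $\Omega$ is of PA (product action) type if it has a unique minimal normal subgroup $M$, $M=T_1\times\cdots\times T_m$ with $m\ge 2$ and isomorphic nonabelian simple groups $T_i$, and for each $\alpha\in\Omega$ there are isomorphic subgroups $1\ne R_i<T_i$ such that the stabilizer $M_\alpha$ is a subdirect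 product of $R_1\times\cdots\times R_m$, that is, $M_\alpha$ projects onto every $R_i$. The type is diagonal if each of the projections $M_\alpha\to R_i$ is injective, and non-diagonal otherwise. -/

import Mathlib

universe u v

namespace ProductAction

/-- `N` is a minimal normal subgroup of `G`: minimal among the nontrivial normal subgroups. -/
def IsMinimalNormal {G : Type u} [Group G] (N : Subgroup G) : Prop :=
  Minimal (fun K : Subgroup G => K.Normal ∧ K ≠ ⊥) N

/-- `N` is the unique minimal normal subgroup of `G`. -/
def IsUniqueMinimalNormal {G : Type u} [Group G] (N : Subgroup G) : Prop :=
  IsMinimalNormal N ∧ ∀ K : Subgroup G, IsMinimalNormal K → K = N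

/-- `X` is an almost simple group with socle `T`: `T` is a nonabelian simple normal subgroup of `X`
on which `X` acts faithfully by conjugation, so that `T ≤ X ≤ Aut(T)`. -/
structure IsAlmostSimpleWithSocle {X : Type u} [Group X] (T : Subgroup X) : Prop where
  normal : T.Normal
  simple : IsSimpleGroup T
  nonabelian : ¬ ∀ x y : T, x * y = y * x
  centralizer_eq_bot : Subgroup.centralizer (T : Set X) = ⊥

/-- The one-dimensional affine group `AGL₁(K)`, the group of all maps `x ↦ a * x + v` with `a ≠ 0`,
as the group of affine automorphisms of the line `K`. -/
abbrev AGL1 (K : Type u) [Field K] : Type u := K ≃ᵃ[K] K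

/-- A subgroup `K` of a direct product is a subdirect product of `∏ i, R i` if its projection to
the `i`-th factor is exactly `R i`, for every `i`. -/
def IsSubdirect {ι : Type v} {A : ι → Type u} [∀ i, Group (A i)]
    (K : Subgroup (∀ i, A i)) (R : ∀ i, Subgroup (A i)) : Prop :=
  ∀ i, K.map (Pi.evalMonoidHom A i) = R i

/-- A quasiprimitive permutation group: faithful and transitive, with all nontrivial normal
subgroups transitive. -/
def IsQuasiprimitive (G : Type u) [Group G] (Ω : Type v) [MulAction G Ω] : Prop :=
  Nonempty Ω ∧ FaithfulSMul G Ω ∧ MulAction.IsQuasiPreprimitive G Ω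

/-- The point stabilizer `M_α`, regarded inside `∏ i, T i` through `e : M ≃* ∏ i, T i`. -/
def stabInProduct {G : Type u} [Group G] {Ω : Type v} [MulAction G Ω] {M : Subgroup G} {n : ℕ}
    {T : Fin n → Type u} [∀ i, Group (T i)] (e : M ≃* ∀ i, T i) (α : Ω) :
    Subgroup (∀ i, T i) :=
  ((MulAction.stabilizer G α).subgroupOf M).map e.toMonoidHom

/-- The decomposition `e : M ≃* T₁ × ⋯ × Tₙ` exhibits product action type for the action of `G`
on `Ω`: `n ≥ 2`, the `T i` are isomorphic nonabelian simple groups, and for each point `α` the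
stabilizer `M_α` is a subdirect product of `R₁ × ⋯ × Rₙ` for isomorphic subgroups
`1 ≠ R i < T i`. -/
structure IsPADecomposition {G : Type u} [Group G] (Ω : Type v) [MulAction G Ω]
    {M : Subgroup G} {n : ℕ} {T : Fin n → Type u} [∀ i, Group (T i)]
    (e : M ≃* ∀ i, T i) : Prop where
  two_le : 2 ≤ n
  simple : ∀ i, IsSimpleGroup (T i)
  nonabelian : ∀ i, ¬ ∀ x y : T i, x * y = y * x
  isomorphic : ∀ i j, Nonempty (T i ≃* T j)
  subdirect : ∀ α : Ω, ∃ R : ∀ i, Subgroup (T i),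
    (∀ i, R i ≠ ⊥ ∧ R i < ⊤) ∧ (∀ i j, Nonempty (R i ≃* R j)) ∧
      IsSubdirect (stabInProduct e α) R

/-- All projections of `M_α` to the direct factors are injective. -/
def IsDiagonalAt {G : Type u} [Group G] {Ω : Type v} [MulAction G Ω]
    {M : Subgroup G} {n : ℕ} {T : Fin n → Type u} [∀ i, Group (T i)]
    (e : M ≃* ∀ i, T i) (α : Ω) : Prop :=
  ∀ i, Set.InjOn (Pi.evalMonoidHom T i) (stabInProduct e α)

/-- `G` is a quasiprimitive permutation group on `Ω` of non-diagonal product action type: it has a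
unique minimal normal subgroup `M`, and `M` has a decomposition of product action type for which
the projections of the point stabilizers `M_α` to the direct factors are not all injective. -/
def IsQuasiprimitiveOfNonDiagonalPAType (G : Type u) [Group G] (Ω : Type v) [MulAction G Ω] :
    Prop :=
  IsQuasiprimitive G Ω ∧
    ∃ M : Subgroup G, IsUniqueMinimalNormal M ∧
      ∃ (n : ℕ) (T : Fin n → Type u) (_ : ∀ i, Group (T i)) (e : M ≃* ∀ i, T i),
        IsPADecomposition Ω e ∧ ∀ α : Ω, ¬ IsDiagonalAt e α

/-- The cyclic group of order `n` acting on `Xⁿ` (coordinates indexed by `ℤ/n`) by shifting the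
coordinates. -/
def shiftAut (X : Type u) [Group X] (n : ℕ) :
    Multiplicative (ZMod n) →* MulAut (ZMod n → X) where
  toFun k :=
    { toFun := fun x i => x (i + k.toAdd)
      invFun := fun x i => x (i - k.toAdd)
      left_inv := fun x => by funext i; simp
      right_inv := fun x => by funext i; simp
      map_mul' := fun x y => rfl }
  map_one' := by ext x i; simp
  map_mul' := fun k l => by ext x i; simp [add_assoc]

/-- The wreath product `X ≀ ⟨τ⟩ = Xⁿ ⋊ ⟨τ⟩` with `τ` the cyclic permutation `(1, 2, …, n)` of the
coordinates. -/
abbrev CyclicWreath (X : Type u) [Group X] (n : ℕ) : Type u :=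
  (ZMod n → X) ⋊[shiftAut X n] Multiplicative (ZMod n)

/-- The inclusion of the base group `Xⁿ` in `X ≀ ⟨τ⟩`. -/
abbrev base (X : Type u) [Group X] (n : ℕ) : (ZMod n → X) →* CyclicWreath X n :=
  SemidirectProduct.inl

/-- The element `τ` of `X ≀ ⟨τ⟩`. -/
def tau (X : Type u) [Group X] (n : ℕ) : CyclicWreath X n :=
  SemidirectProduct.inr (Multiplicative.ofAdd 1)

/-- `(x₁, x₂, …, xₙ)^τ = (xₙ, x₁, …, xₙ₋₁)`. -/
theorem tau_conj {X : Type u} [Group X] {n : ℕ} (x : ZMod n → X) :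
    (tau X n)⁻¹ * base X n x * tau X n = base X n (fun i => x (i - 1)) := by
  have h := SemidirectProduct.inl_aut_inv (φ := shiftAut X n) (Multiplicative.ofAdd 1) x
  rw [tau, base, ← map_inv, ← h]
  congr 1

/-- `d₀ = (bc, b, bc, …, bc)`, where the entry `b` has index `2`. -/
def dVec {X : Type u} [Group X] (n : ℕ) (b c : X) : ZMod n → X :=
  fun i => if i = 2 then b else b * c

/-- `θ = d₀ τ`. -/
def theta {X : Type u} [Group X] (n : ℕ) (b c : X) : CyclicWreath X n :=
  base X n (dVec n b c) * tau X n

/-- The direct power `Yⁿ` of a subgroup `Y ≤ X`, as a subgroup of `Xⁿ`. -/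
def power {X : Type u} [Group X] (n : ℕ) (Y : Subgroup X) : Subgroup (ZMod n → X) :=
  Subgroup.pi Set.univ fun _ => Y

/-- The subgroup `L⟨θ⟩` of `X ≀ ⟨τ⟩` generated by a subgroup `L` of the base group and `θ`. -/
def extendByTheta {X : Type u} [Group X] (n : ℕ) (b c : X) (L : Subgroup (ZMod n → X)) :
    Subgroup (CyclicWreath X n) :=
  L.map (base X n) ⊔ Subgroup.zpowers (theta n b c)

end ProductAction

open ProductAction

/-! Everything rests on the n-th power of θ. Its component along ⟨τ⟩ is trivial and it commutes with
θ, so, ⟨b⟩ × ⟨c⟩ being abelian, it is a constant vector (l, …, l) with l ∈ ⟨b⟩ × ⟨c⟩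
(`theta_pow_eq_base_const`). Hence θ ^ (n(q − 1)) = 1, and n(q − 1) = q² − 1 = |E| − 1. Transitivity
on E ∖ {1} then forces θ to have order exactly q² − 1 and to act regularly there
(`zpow_eq_one_of_transitive`).

Three consequences follow. The endomorphisms of E commuting with θ form a field of order q², on
which θ acts as a generator of the multiplicative group, so E⟨θ⟩ is AGL₁(q²). The element l has
order q − 1 and generates ⟨b⟩ × ⟨c⟩. Finally θⁿ fixes no nontrivial element of E, so E consists of
commutators with (l, …, l); as X/T is abelian, E ≤ Tⁿ (`le_power_of_free`), whence F ≤ T and H ≤ G.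

The base part of H is E⟨(l, …, l)⟩, which projects onto F⟨l⟩ = R in each coordinate; since F ≤ T,
its intersection with Tⁿ projects onto R ∩ T. Every nontrivial normal subgroup of G contains Tⁿ
(`power_le_of_normalized`), and Tⁿ is transitive on the cosets of H because θ ∈ H, so the action is
quasiprimitive. It is non-diagonal because |E| = q² > q = |F|, so a coordinate projection of E has a
kernel. -/

/-! ### Transitive cyclic actions, finite fields and AGL₁ -/

/-- If the powers of an automorphism `φ` of an abelian group of order `p ^ m` are transitive on the
nonzero elements, then the group is the field of order `p ^ m` with `φ` acting as a scalar. -/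
theorem exists_galoisField_addEquiv_of_transitive {p m : ℕ} [Fact p.Prime] (hm : m ≠ 0)
    {V : Type*} [AddCommGroup V] (hV : Nat.card V = p ^ m) (φ : AddMonoid.End V) {N : ℕ}
    (hN : 0 < N) (hφN : φ ^ N = 1) (a : V) (ha : a ≠ 0)
    (htrans : ∀ v : V, v ≠ 0 → ∃ k : ℕ, (φ ^ k) a = v) :
    ∃ (σ : GaloisField p m ≃+ V) (g : GaloisField p m), ∀ x, σ (g * x) = φ (σ x) := by
  -- Evaluation at `a` identifies the centralizer of `φ` with V: an endomorphism commuting with `φ`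
  -- is determined by its value at `a`, and every nonzero vector is the value of a power of `φ`. So
  -- the nonzero elements of `L` are powers of `φ`, which makes `L` a field.
  let L : Subring (AddMonoid.End V) := Subring.centralizer {φ}
  have hφL : φ ∈ L := by simp [L, Subring.mem_centralizer_iff]
  have hcomm : ∀ (u : L) (k : ℕ), φ ^ k * u.1 = u.1 * φ ^ k := fun u k => by
    have h : Commute φ u.1 := Subring.mem_centralizer_iff.1 u.2 φ rfl
    exact (h.pow_left k)
  let ev : L →+ V :=
    { toFun := fun u => u.1 a
      map_zero' := rfl
      map_add' := fun _ _ => rfl }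
  have hinj : Function.Injective ev := by
    rw [injective_iff_map_eq_zero]
    intro u hu
    have hu : u.1 a = 0 := hu
    apply Subtype.ext
    ext v
    by_cases hv : v = 0
    · subst hv; simp
    obtain ⟨k, rfl⟩ := htrans v hv
    have h : (φ ^ k) (u.1 a) = u.1 ((φ ^ k) a) := DFunLike.congr_fun (hcomm u k) a
    rw [hu, map_zero] at h
    exact h.symm
  have hsurj : Function.Surjective ev := by
    intro v
    by_cases hv : v = 0
    · exact ⟨0, by simp [hv]⟩
    obtain ⟨k, hk⟩ := htrans v hv
    exact ⟨⟨φ, hφL⟩ ^ k, hk⟩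
  have hpow : ∀ u : L, u ≠ 0 → ∃ k : ℕ, u = ⟨φ, hφL⟩ ^ k := by
    intro u hu
    obtain ⟨k, hk⟩ := htrans (ev u) (fun h => hu (hinj (by simpa using h)))
    exact ⟨k, hinj hk.symm⟩
  have hone : (⟨φ, hφL⟩ : L) ^ N = 1 := Subtype.ext hφN
  have hL : IsField L :=
    { exists_pair_ne := ⟨0, 1, fun h => ha (congrArg ev h).symm⟩
      mul_comm := by
        intro x y
        by_cases hx : x = 0
        · simp [hx]
        by_cases hy : y = 0
        · simp [hy]
        obtain ⟨k, rfl⟩ := hpow x hx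
        obtain ⟨l, rfl⟩ := hpow y hy
        rw [← pow_add, ← pow_add, add_comm]
      mul_inv_cancel := by
        intro x hx
        obtain ⟨k, rfl⟩ := hpow x hx
        refine ⟨⟨φ, hφL⟩ ^ (k * (N - 1)), ?_⟩
        rw [← pow_add, show k + k * (N - 1) = N * k by
          obtain ⟨M, rfl⟩ := Nat.exists_eq_succ_of_ne_zero hN.ne'
          simp; ring, pow_mul, hone, one_pow] }
  let e : L ≃+ V := AddEquiv.ofBijective ev ⟨hinj, hsurj⟩
  let := hL.toField
  have hcard : Nat.card L = p ^ m := (Nat.card_congr e.toEquiv).trans hV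
  have : Finite L := Nat.finite_of_card_ne_zero (by
    rw [hcard]; exact (pow_pos (Fact.out : p.Prime).pos m).ne')
  let := Fintype.ofFinite L
  let := Fintype.ofFinite (GaloisField p m)
  let r : GaloisField p m ≃+* L := FiniteField.ringEquivOfCardEq (by
    rw [← Nat.card_eq_fintype_card, ← Nat.card_eq_fintype_card, hcard, GaloisField.card p m hm])
  refine ⟨r.toAddEquiv.trans e, r.symm ⟨φ, hφL⟩, fun x => ?_⟩
  change ev (r (r.symm ⟨φ, hφL⟩ * x)) = φ (ev (r x))
  rw [map_mul, RingEquiv.apply_symm_apply]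
  rfl

/-- A group is `AGL₁(K)` if it is an extension of the additive group of `K` by a complement
isomorphic to `Kˣ` which acts by multiplication. -/
theorem nonempty_mulEquiv_AGL1_of_complement {H : Type*} [Group H] {K : Type*} [Field K]
    (σ : Multiplicative K →* H) (χ : Kˣ →* H) (hσ : Function.Injective σ)
    (hχ : Function.Injective χ)
    (hact : ∀ (u : Kˣ) (x : K),
      χ u * σ (Multiplicative.ofAdd x) * (χ u)⁻¹ = σ (Multiplicative.ofAdd (u * x)))
    (hdisj : σ.range ⊓ χ.range = ⊥) (htop : ∀ h : H, ∃ x u, σ x * χ u = h) :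
    Nonempty (H ≃* AGL1 K) := by
  let lin : AGL1 K →* Kˣ :=
    { toFun := fun α => Units.mk0 (α.linear 1) (by simp)
      map_one' := by ext; rfl
      map_mul' := fun α β => by
        ext
        change α.linear (β.linear 1) = α.linear 1 * β.linear 1
        rw [← mul_one (β.linear 1), ← smul_eq_mul, map_smul]
        simp [mul_comm] }
  have hlin : ∀ (α : AGL1 K) (x : K), α x = lin α * x + α 0 := by
    intro α x
    have h1 := α.map_vadd 0 x
    simp only [vadd_eq_add, add_zero] at h1
    rw [h1]
    congr 1
    change α.linear x = α.linear 1 * x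
    conv_lhs => rw [← mul_one x, ← smul_eq_mul, map_smul]
    simp [mul_comm]
  -- The map x ↦ u * x + v goes to σ(v)χ(u).
  let Φ : AGL1 K →* H :=
    { toFun := fun α => σ (Multiplicative.ofAdd (α 0)) * χ (lin α)
      map_one' := by
        have : (1 : AGL1 K) 0 = 0 := rfl
        simp [this]
      map_mul' := fun α β => by
        have h : (α * β) 0 = α 0 + lin α * β 0 := by
          rw [AffineEquiv.coe_mul, Function.comp_apply, hlin α (β 0), add_comm]
        rw [h, ofAdd_add, map_mul σ, map_mul lin, map_mul χ, ← hact]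
        group }
  have hΦ : Function.Bijective Φ := by
    constructor
    · rw [injective_iff_map_eq_one]
      intro α hα
      have hα : σ (Multiplicative.ofAdd (α 0)) * χ (lin α) = 1 := hα
      have hmem : σ (Multiplicative.ofAdd (α 0)) ∈ σ.range ⊓ χ.range :=
        ⟨⟨_, rfl⟩, ⟨(lin α)⁻¹, by rw [map_inv]; exact (eq_inv_of_mul_eq_one_left hα).symm⟩⟩
      rw [hdisj, Subgroup.mem_bot] at hmem
      rw [hmem, one_mul] at hα
      have h0 : α 0 = 0 := hσ (hmem.trans (map_one σ).symm)
      have h1 : lin α = 1 := hχ (hα.trans (map_one χ).symm)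
      ext x
      rw [hlin, h0, h1]
      simp
    · intro h
      obtain ⟨x, u, rfl⟩ := htop h
      let α : AGL1 K := (LinearEquiv.smulOfUnit u : K ≃ₗ[K] K).toAffineEquiv.trans
        (AffineEquiv.constVAdd K K x.toAdd)
      have hα : ∀ y, α y = x.toAdd + u * y := fun y => rfl
      have h0 : α 0 = x.toAdd := by simp [hα]
      refine ⟨α, ?_⟩
      change σ (Multiplicative.ofAdd (α 0)) * χ (lin α) = _
      have h1 : lin α = u := by
        ext
        have := hlin α 1
        rw [h0, hα] at this
        simpa [add_comm x.toAdd] using this.symm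
      rw [h0, h1]
      rfl
  exact ⟨(MulEquiv.ofBijective Φ hΦ).symm⟩

section TransitiveCyclicAction

variable {H : Type*} [Group H] {p m : ℕ} [Fact p.Prime] {A : Subgroup H} {z : H}

theorem card_of_mulEquiv_pi_zmod (hA : Nonempty (A ≃* Multiplicative (Fin m → ZMod p))) :
    Nat.card A = p ^ m := by
  obtain ⟨e⟩ := hA
  rw [Nat.card_congr e.toEquiv, Nat.card_congr Multiplicative.toAdd]
  simp

theorem commute_of_mulEquiv_multiplicative {V : Type*} [AddCommGroup V]
    (hA : Nonempty (A ≃* Multiplicative V)) {x y : H} (hx : x ∈ A) (hy : y ∈ A) :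
    x * y = y * x := by
  obtain ⟨e⟩ := hA
  have : (⟨x, hx⟩ : A) * ⟨y, hy⟩ = ⟨y, hy⟩ * ⟨x, hx⟩ := e.injective (by
    rw [map_mul, map_mul, mul_comm])
  exact congrArg Subtype.val this

theorem exists_mem_ne_one_of_card {N : ℕ} (hA : Nat.card A = N) (hN : 1 < N) :
    ∃ x ∈ A, x ≠ 1 := by
  by_contra! h
  have : A = ⊥ := (Subgroup.eq_bot_iff_forall A).2 h
  rw [this] at hA
  simp at hA
  omega

/-- A power of `z` that fixes some nontrivial element of `A` is trivial. -/
theorem zpow_eq_one_of_transitive {N : ℕ} (hcard : Nat.card A = N + 1) (hN : 0 < N)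
    (hz : z ^ N = 1)
    (htrans : ∀ x ∈ A, ∀ y ∈ A, x ≠ 1 → y ≠ 1 → ∃ g ∈ Subgroup.zpowers z, g * x * g⁻¹ = y) :
    orderOf z = N ∧ ∀ k ∈ Subgroup.zpowers z, ∀ x ∈ A, x ≠ 1 → k * x * k⁻¹ = x → k = 1 := by
  have hfin : IsOfFinOrder z := isOfFinOrder_iff_pow_eq_one.2 ⟨N, hN, hz⟩
  have : Finite (Subgroup.zpowers z) := hfin.finite_zpowers
  have : Finite A := Nat.finite_of_card_ne_zero (by omega)
  have key : ∀ x ∈ A, x ≠ 1 → orderOf z = N ∧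
      ∀ k ∈ Subgroup.zpowers z, k * x * k⁻¹ = x → k = 1 := by
    intro x hx hx1
    let B : Set A := {1}ᶜ
    have hB : Nat.card B = N := by
      have := Set.ncard_add_ncard_compl ({1} : Set A)
      rw [Set.ncard_singleton, hcard] at this
      exact Nat.add_left_cancel (this.trans (add_comm N 1))
    have hch : ∀ y : B, ∃ g : Subgroup.zpowers z, g.1 * x * g.1⁻¹ = y.1.1 := fun y => by
      obtain ⟨g, hg, h⟩ := htrans x hx y.1.1 y.1.2 hx1
        (fun h => y.2 (by simpa using Subtype.ext h))
      exact ⟨⟨g, hg⟩, h⟩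
    -- Distinct targets need distinct conjugators, so N ≤ |⟨z⟩| ≤ N and `s` is a bijection. If k
    -- fixes x, then both k and 1 are the chosen conjugator for x, so k = 1.
    choose s hs using hch
    have hsinj : Function.Injective s := fun y y' h => by
      apply Subtype.ext; apply Subtype.ext
      rw [← hs, ← hs, h]
    have hle : orderOf z ≤ N := orderOf_le_of_pow_eq_one hN hz
    have hcardz : Nat.card (Subgroup.zpowers z) = orderOf z := Nat.card_zpowers z
    have hge : N ≤ orderOf z := by
      rw [← hB, ← hcardz]; exact Nat.card_le_card_of_injective s hsinj
    have hord := le_antisymm hle hge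
    refine ⟨hord, ?_⟩
    have hsbij : Function.Bijective s :=
      (Nat.bijective_iff_injective_and_card s).2 ⟨hsinj, by rw [hB, hcardz, hord]⟩
    intro k hk hkx
    obtain ⟨y, hy⟩ := hsbij.2 ⟨k, hk⟩
    obtain ⟨y', hy'⟩ := hsbij.2 1
    have h1 := hs y
    have h2 := hs y'
    rw [hy] at h1
    rw [hy'] at h2
    have hyy : y = y' := by
      apply Subtype.ext; apply Subtype.ext
      rw [← h1, ← h2]
      simpa using hkx
    have : (⟨k, hk⟩ : Subgroup.zpowers z) = 1 := by rw [← hy, ← hy', hyy]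
    exact congrArg Subtype.val this
  obtain ⟨x, hx, hx1⟩ := exists_mem_ne_one_of_card hcard (by omega)
  exact ⟨(key x hx hx1).1, fun k hk x hx hx1 => (key x hx hx1).2 k hk⟩

/-- A group `A⟨z⟩` with `A` elementary abelian of order `p ^ m` and `⟨z⟩` of order at most
`p ^ m - 1`, transitive on the nontrivial elements of `A`, is isomorphic to `AGL₁(p ^ m)`. -/
theorem nonempty_mulEquiv_AGL1_of_transitive (hm : m ≠ 0) [hAn : A.Normal]
    (hA : Nonempty (A ≃* Multiplicative (Fin m → ZMod p)))
    (htop : A ⊔ Subgroup.zpowers z = ⊤) (hz : z ^ (p ^ m - 1) = 1)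
    (htrans : ∀ x ∈ A, ∀ y ∈ A, x ≠ 1 → y ≠ 1 → ∃ g ∈ Subgroup.zpowers z, g * x * g⁻¹ = y) :
    A ⊓ Subgroup.zpowers z = ⊥ ∧ Nonempty (H ≃* AGL1 (GaloisField p m)) := by
  have hp1 : 1 < p ^ m := Nat.one_lt_pow hm (Fact.out : p.Prime).one_lt
  have hcard : Nat.card A = p ^ m := card_of_mulEquiv_pi_zmod hA
  have hcomm : ∀ x ∈ A, ∀ y ∈ A, x * y = y * x := fun x hx y hy =>
    commute_of_mulEquiv_multiplicative hA hx hy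
  obtain ⟨hord, hfree⟩ := zpow_eq_one_of_transitive (N := p ^ m - 1) (by omega) (by omega) hz htrans
  obtain ⟨a, haA, ha1⟩ := exists_mem_ne_one_of_card hcard hp1
  have hdisj : A ⊓ Subgroup.zpowers z = ⊥ := by
    rw [Subgroup.eq_bot_iff_forall]
    rintro x ⟨hxA, hxz⟩
    exact hfree x hxz a haA ha1 (by rw [hcomm x hxA a haA, mul_inv_cancel_right])
  refine ⟨hdisj, ?_⟩
  let : CommGroup A := { (inferInstance : Group A) with
    mul_comm := fun x y => Subtype.ext (hcomm x x.2 y y.2) }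
  let φ : AddMonoid.End (Additive A) := MonoidHom.toAdditive (MulAut.conjNormal z).toMonoidHom
  have hφ : ∀ x : Additive A, ((φ x).toMul : H) = z * (x.toMul : H) * z⁻¹ := fun x => rfl
  have hφk : ∀ (k : ℕ) (x : Additive A),
      (((φ ^ k) x).toMul : H) = z ^ k * (x.toMul : H) * (z ^ k)⁻¹ := by
    intro k
    induction k with
    | zero => intro x; simp
    | succ k ih =>
      intro x
      have h : (φ ^ (k + 1)) x = φ ((φ ^ k) x) := by rw [pow_succ']; rfl
      rw [h, hφ, ih, pow_succ']
      group
  have hfin : IsOfFinOrder z := isOfFinOrder_iff_pow_eq_one.2 ⟨_, by omega, hz⟩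
  obtain ⟨σ, g, hσ⟩ := exists_galoisField_addEquiv_of_transitive (p := p) hm (V := Additive A)
    (by rw [← hcard]; rfl) φ (N := p ^ m - 1) (by omega)
    (by
      refine AddMonoidHom.ext fun x => Subtype.ext ?_
      have := hφk (p ^ m - 1) x
      rw [hz] at this
      exact this.trans (by rw [one_mul, inv_one, mul_one]; rfl))
    (Additive.ofMul ⟨a, haA⟩) (fun h => ha1 (congrArg (fun x : Additive A => (x.toMul : H)) h))
    (fun v hv => by
      obtain ⟨g, hg, hgv⟩ := htrans a haA v.toMul v.toMul.2 ha1
        (fun h => hv (by exact Subtype.ext h))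
      obtain ⟨k, rfl⟩ := (Submonoid.mem_powers_iff _ _).1 (hfin.mem_powers_iff_mem_zpowers.2 hg)
      exact ⟨k, Subtype.ext ((hφk k _).trans hgv)⟩)
  have hσk : ∀ (k : ℕ) x, σ (g ^ k * x) = (φ ^ k) (σ x) := by
    intro k
    induction k with
    | zero => intro x; simp
    | succ k ih => intro x; rw [pow_succ', pow_succ', mul_assoc, hσ, ih]; rfl
  let s : Multiplicative (GaloisField p m) →* H :=
    A.subtype.comp (AddMonoidHom.toMultiplicativeLeft σ.toAddMonoidHom)
  have hs : ∀ x, s (Multiplicative.ofAdd x) = ((σ x).toMul : H) := fun x => rfl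
  have hsinj : Function.Injective s := fun x y h => σ.injective (Subtype.ext h)
  have hsrange : s.range = A := by
    ext x
    constructor
    · rintro ⟨y, rfl⟩; exact Subtype.property _
    · intro hx
      exact ⟨Multiplicative.ofAdd (σ.symm (Additive.ofMul ⟨x, hx⟩)), by rw [hs]; simp⟩
  -- If `g` were 0, a positive power of `φ` would vanish, while z ^ (p ^ m - 1) = 1 acts as the
  -- identity.
  have hg0 : g ≠ 0 := by
    rintro rfl
    have h1 := hσk (p ^ m - 1) 1
    have h2 := hφk (p ^ m - 1) (σ 1)
    rw [← h1, hz, zero_pow (by omega), zero_mul, map_zero] at h2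
    have h3 : σ 1 = 0 := by
      apply Subtype.ext
      simpa using h2.symm
    exact one_ne_zero (σ.injective (h3.trans (map_zero σ).symm))
  let g' : (GaloisField p m)ˣ := Units.mk0 g hg0
  -- Transitivity applied to σ(1) and σ(u) makes u a power of `g`. Thus `g'` and `z` generate cyclic
  -- groups of the same order, and `g' ↦ z` extends to an isomorphism.
  have hgen : ∀ u : (GaloisField p m)ˣ, u ∈ Subgroup.zpowers g' := by
    intro u
    have hne : ∀ x : GaloisField p m, x ≠ 0 → ((σ x).toMul : H) ≠ 1 := fun x hx h =>
      hx (σ.injective ((Subtype.ext h : σ x = 0).trans (map_zero σ).symm))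
    obtain ⟨w, hw, hwv⟩ := htrans _ (σ 1).toMul.2 _ (σ u).toMul.2 (hne 1 one_ne_zero)
      (hne u u.ne_zero)
    obtain ⟨k, rfl⟩ := (Submonoid.mem_powers_iff _ _).1 (hfin.mem_powers_iff_mem_zpowers.2 hw)
    have h : σ (g ^ k * 1) = σ u := by
      rw [hσk]; exact Subtype.ext ((hφk k _).trans hwv)
    refine ⟨k, Units.ext ?_⟩
    simpa [g'] using σ.injective h
  have hgord : orderOf g' = orderOf z := by
    rw [orderOf_eq_card_of_forall_mem_zpowers hgen, Nat.card_units, GaloisField.card p m hm, hord]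
  have hgen' : ∀ w : Subgroup.zpowers z,
      w ∈ Subgroup.zpowers (⟨z, Subgroup.mem_zpowers z⟩ : Subgroup.zpowers z) := by
    rintro ⟨w, k, rfl⟩
    exact ⟨k, Subtype.ext (by simp)⟩
  let e := mulEquivOfOrderOfEq hgen hgen' (by rw [hgord, Subgroup.orderOf_mk])
  have heg : e g' = ⟨z, Subgroup.mem_zpowers z⟩ := mulEquivOfOrderOfEq_apply_gen _ _ _
  let χ : (GaloisField p m)ˣ →* H := (Subgroup.zpowers z).subtype.comp e.toMonoidHom
  have hχ : ∀ u, χ u = (e u : H) := fun u => rfl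
  have hχrange : χ.range = Subgroup.zpowers z := by
    ext x
    constructor
    · rintro ⟨y, rfl⟩; exact Subtype.property _
    · intro hx
      exact ⟨e.symm ⟨x, hx⟩, by rw [hχ]; simp⟩
  refine nonempty_mulEquiv_AGL1_of_complement s χ hsinj
    (fun x y h => e.injective (Subtype.ext h)) ?_ (by rw [hsrange, hχrange, hdisj]) ?_
  · intro u x
    have : u ∈ Submonoid.powers g' :=
      (isOfFinOrder_of_finite g').mem_powers_iff_mem_zpowers.2 (hgen u)
    obtain ⟨k, rfl⟩ := (Submonoid.mem_powers_iff _ _).1 this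
    rw [map_pow, hχ, heg, hs, hs]
    have h1 : ((g' ^ k : (GaloisField p m)ˣ) : GaloisField p m) = g ^ k := by simp [g']
    rw [h1, hσk, hφk]
  · intro h
    have hh : h ∈ A ⊔ Subgroup.zpowers z := htop ▸ Subgroup.mem_top h
    obtain ⟨x, hx, w, hw, rfl⟩ := Subgroup.mem_sup_of_normal_left.1 hh
    rw [← hsrange] at hx
    rw [← hχrange] at hw
    obtain ⟨x, rfl⟩ := hx
    obtain ⟨w, rfl⟩ := hw
    exact ⟨x, w, rfl⟩

end TransitiveCyclicAction

/-! ### Conjugation in the cyclic wreath product and powers of θ -/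

section Wreath

variable {X : Type u} [Group X] {n : ℕ}

theorem conj_base (w : CyclicWreath X n) (x : ZMod n → X) :
    w * base X n x * w⁻¹ =
      base X n (fun i => w.left i * x (i + w.right.toAdd) * (w.left i)⁻¹) := by
  rw [mul_inv_eq_iff_eq_mul]
  apply SemidirectProduct.ext
  · funext i
    simp [shiftAut]
  · simp

theorem mem_power {Y : Subgroup X} {x : ZMod n → X} : x ∈ power n Y ↔ ∀ i, x i ∈ Y := by
  simp [power, Subgroup.mem_pi]

theorem base_injective : Function.Injective (base X n) := SemidirectProduct.inl_injective

theorem base_mem_map {E : Subgroup (ZMod n → X)} {x : ZMod n → X} :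
    base X n x ∈ E.map (base X n) ↔ x ∈ E :=
  Subgroup.mem_map_iff_mem base_injective

theorem eq_base_of_right_eq_one {w : CyclicWreath X n} (hw : w.right = 1) :
    w = base X n w.left := SemidirectProduct.ext rfl hw

theorem theta_left (b c : X) : (theta n b c).left = dVec n b c := by
  simp [theta, tau]

theorem theta_right (b c : X) : (theta n b c).right = Multiplicative.ofAdd 1 := by
  simp [theta, tau]

theorem dVec_mem {D : Subgroup X} {b c : X} (hb : b ∈ D) (hc : c ∈ D) (i : ZMod n) :
    dVec n b c i ∈ D := by
  unfold dVec
  split_ifs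
  · exact hb
  · exact D.mul_mem hb hc

/-- The elements of `X ≀ ⟨τ⟩` with base part in `Dⁿ`. -/
def wreathSubgroup (n : ℕ) (D : Subgroup X) : Subgroup (CyclicWreath X n) where
  carrier := {w | ∀ i, w.left i ∈ D}
  one_mem' := fun _ => D.one_mem
  mul_mem' := fun {x y} hx hy i => by
    rw [SemidirectProduct.mul_left]
    exact D.mul_mem (hx i) (hy _)
  inv_mem' := fun {x} hx i => by
    rw [SemidirectProduct.inv_left]
    exact D.inv_mem (hx _)

theorem zpowers_theta_le {D : Subgroup X} {b c : X} (hb : b ∈ D) (hc : c ∈ D) :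
    Subgroup.zpowers (theta n b c) ≤ wreathSubgroup n D := by
  rw [Subgroup.zpowers_le]
  intro i
  rw [theta_left]
  exact dVec_mem hb hc i

theorem theta_zpow_right (b c : X) (k : ℤ) :
    ((theta n b c) ^ k).right = Multiplicative.ofAdd (k : ZMod n) := by
  have h := map_zpow (SemidirectProduct.rightHom : CyclicWreath X n →* _) (theta n b c) k
  simp only [SemidirectProduct.rightHom_eq_right] at h
  rw [h, theta_right, ← ofAdd_zsmul, zsmul_one]

/-- `θⁿ` is a constant vector. -/
theorem theta_pow_eq_base_const {D : Subgroup X} (hD : ∀ x ∈ D, ∀ y ∈ D, x * y = y * x)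
    {b c : X} (hb : b ∈ D) (hc : c ∈ D) :
    ∃ l ∈ D, (theta n b c) ^ n = base X n (fun _ => l) := by
  set θ := theta n b c with hθ
  have hmem : ∀ i, (θ ^ n).left i ∈ D := zpowers_theta_le hb hc ⟨n, by simp [hθ]⟩
  have hright : (θ ^ n).right = 1 := by
    have := theta_zpow_right (n := n) b c n
    simpa using this
  have hbase := eq_base_of_right_eq_one hright
  -- Conjugation by θ shifts coordinates and twists them by elements of the abelian group `D`, which
  -- has no effect here; so consecutive coordinates of θⁿ agree.
  have hconj : θ * θ ^ n * θ⁻¹ = θ ^ n := by group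
  rw [hbase, conj_base] at hconj
  have hstep : ∀ i, (θ ^ n).left (i + 1) = (θ ^ n).left i := by
    intro i
    have h := congrFun (base_injective hconj) i
    simp only [hθ, theta_left, theta_right, toAdd_ofAdd] at h
    rw [← h, hD _ (dVec_mem hb hc i) _ (hmem _), mul_inv_cancel_right]
  refine ⟨(θ ^ n).left 0, hmem 0, ?_⟩
  rw [hbase]
  congr 1
  funext i
  obtain ⟨k, rfl⟩ := ZMod.intCast_surjective i
  simp only [SemidirectProduct.left_inl]
  induction k using Int.induction_on with
  | zero => simp
  | succ k ih => rw [← ih]; push_cast; exact hstep _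
  | pred k ih =>
    rw [← ih, ← hstep]
    push_cast
    rw [sub_add_cancel]

/-- The subgroup generated by two commuting elements consists of products of powers. -/
theorem zpowers_sup_zpowers_of_commute [Finite X] {b c : X} (hbc : b * c = c * b) {N : ℕ}
    (hb : orderOf b ∣ N) (hc : orderOf c ∣ N) :
    (∀ x ∈ Subgroup.zpowers b ⊔ Subgroup.zpowers c,
      ∀ y ∈ Subgroup.zpowers b ⊔ Subgroup.zpowers c, x * y = y * x) ∧
    (∀ x ∈ Subgroup.zpowers b ⊔ Subgroup.zpowers c, x ^ N = 1) ∧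
    Nat.card ↥(Subgroup.zpowers b ⊔ Subgroup.zpowers c) ≤ orderOf b * orderOf c ∧
    b ∈ Subgroup.zpowers b ⊔ Subgroup.zpowers c ∧ c ∈ Subgroup.zpowers b ⊔ Subgroup.zpowers c := by
  have hcom : ∀ (m : Subgroup.zpowers b) (m' : Subgroup.zpowers c),
      Commute ((Subgroup.zpowers b).subtype m) ((Subgroup.zpowers c).subtype m') := by
    rintro ⟨_, i, rfl⟩ ⟨_, j, rfl⟩
    exact ((show Commute b c from hbc).zpow_zpow i j)
  have hr := MonoidHom.noncommCoprod_range _ _ hcom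
  rw [Subgroup.range_subtype, Subgroup.range_subtype] at hr
  have hform : ∀ x ∈ Subgroup.zpowers b ⊔ Subgroup.zpowers c, ∃ i j : ℤ, x = b ^ i * c ^ j := by
    intro x hx
    rw [← hr] at hx
    obtain ⟨⟨⟨_, i, rfl⟩, ⟨_, j, rfl⟩⟩, rfl⟩ := hx
    exact ⟨i, j, rfl⟩
  have hC : Commute b c := hbc
  refine ⟨?_, ?_, ?_, Subgroup.mem_sup_left (Subgroup.mem_zpowers b),
    Subgroup.mem_sup_right (Subgroup.mem_zpowers c)⟩
  · intro x hx y hy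
    obtain ⟨i, j, rfl⟩ := hform x hx
    obtain ⟨k, l, rfl⟩ := hform y hy
    have h1 : Commute (b ^ i) (b ^ k * c ^ l) :=
      ((Commute.refl b).zpow_zpow i k).mul_right (hC.zpow_zpow i l)
    have h2 : Commute (c ^ j) (b ^ k * c ^ l) :=
      (hC.symm.zpow_zpow j k).mul_right ((Commute.refl c).zpow_zpow j l)
    exact h1.mul_left h2
  · intro x hx
    obtain ⟨i, j, rfl⟩ := hform x hx
    rw [(hC.zpow_zpow i j).mul_pow, ← zpow_natCast, ← zpow_natCast, zpow_comm, zpow_comm c]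
    rw [zpow_natCast, zpow_natCast, orderOf_dvd_iff_pow_eq_one.1 hb,
      orderOf_dvd_iff_pow_eq_one.1 hc]
    simp
  · rw [← hr]
    refine (Nat.card_le_card_of_surjective _ (MonoidHom.rangeRestrict_surjective _)).trans ?_
    rw [Nat.card_prod, Nat.card_zpowers, Nat.card_zpowers]

/-! ### Subgroups of the wreath product normalized by Tⁿ and θ -/

section Socle

variable {T : Subgroup X}

theorem ProductAction.IsAlmostSimpleWithSocle.exists_not_commute (hT : IsAlmostSimpleWithSocle T) {x : X} (hx : x ≠ 1) :
    ∃ t ∈ T, t * x ≠ x * t := by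
  by_contra! h
  have : x ∈ Subgroup.centralizer (T : Set X) := Subgroup.mem_centralizer_iff.2 h
  rw [hT.centralizer_eq_bot] at this
  exact hx (Subgroup.mem_bot.1 this)

theorem ProductAction.IsAlmostSimpleWithSocle.exists_mem_ne_one
    (hT : IsAlmostSimpleWithSocle T) : ∃ t ∈ T, t ≠ 1 := by
  by_contra! h
  exact hT.nonabelian fun x y => Subtype.ext (by simp [h x x.2, h y y.2])

/-- Constant vectors t show that each coordinate of w centralizes T and so is trivial. A vector
supported at one coordinate then rules out a nontrivial rotation. -/
theorem ProductAction.IsAlmostSimpleWithSocle.eq_one_of_centralizes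
    (hT : IsAlmostSimpleWithSocle T) {w : CyclicWreath X n}
    (hw : ∀ t ∈ power n T, w * base X n t * w⁻¹ = base X n t) : w = 1 := by
  classical
  have hcoord : ∀ t ∈ power n T, ∀ i, w.left i * t (i + w.right.toAdd) * (w.left i)⁻¹ = t i := by
    intro t ht i
    have h := hw t ht
    rw [conj_base] at h
    exact congrFun (base_injective h) i
  have hleft : ∀ i, w.left i = 1 := by
    intro i
    by_contra h
    obtain ⟨t, ht, hne⟩ := hT.exists_not_commute h
    exact hne (mul_inv_eq_iff_eq_mul.1
      (hcoord (fun _ => t) (mem_power.2 fun _ => ht) i)).symm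
  have hright : w.right.toAdd = 0 := by
    by_contra h
    obtain ⟨t, ht, ht1⟩ := hT.exists_mem_ne_one
    have := hcoord (Pi.mulSingle 0 t) (mem_power.2 fun i => by
      by_cases hi : i = 0
      · subst hi; simpa using ht
      · simp [Pi.mulSingle_eq_of_ne hi, T.one_mem]) 0
    rw [zero_add, Pi.mulSingle_eq_of_ne h] at this
    simp only [mul_one, mul_inv_cancel, Pi.mulSingle_eq_same] at this
    exact ht1 this.symm
  exact SemidirectProduct.ext (funext hleft) (toAdd_eq_zero.1 hright)

theorem ProductAction.IsAlmostSimpleWithSocle.base_conj_mem (hT : IsAlmostSimpleWithSocle T)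
    (w : CyclicWreath X n) {t : ZMod n → X}
    (ht : t ∈ power n T) :
    ∃ t' ∈ power n T, w * base X n t * w⁻¹ = base X n t' := by
  refine ⟨_, mem_power.2 fun i => ?_, conj_base w t⟩
  exact hT.normal.conj_mem _ (mem_power.1 ht _) _

/-- A nontrivial subgroup of `X ≀ ⟨τ⟩` normalized by `Tⁿ` and `θ` contains `Tⁿ`. -/
theorem ProductAction.IsAlmostSimpleWithSocle.power_le_of_normalized
    (hT : IsAlmostSimpleWithSocle T) [NeZero n] {b c : X}
    {N : Subgroup (CyclicWreath X n)} (hN : N ≠ ⊥)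
    (hNT : ∀ t ∈ power n T, ∀ x ∈ N, base X n t * x * (base X n t)⁻¹ ∈ N)
    (hNθ : ∀ x ∈ N, theta n b c * x * (theta n b c)⁻¹ ∈ N) :
    (power n T).map (base X n) ≤ N := by
  classical
  have hsingle : ∀ (i : ZMod n) (u : X), u ∈ T → Pi.mulSingle i u ∈ power n T := by
    intro i u hu
    refine mem_power.2 fun j => ?_
    by_cases hj : j = i
    · subst hj; simpa using hu
    · simp [Pi.mulSingle_eq_of_ne hj, T.one_mem]
  have hcomm : ∀ x ∈ N, ∀ t ∈ power n T, x * base X n t * x⁻¹ * (base X n t)⁻¹ ∈ N := by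
    intro x hx t ht
    have := N.mul_mem hx (hNT t ht _ (N.inv_mem hx))
    simpa only [mul_assoc] using this
  obtain ⟨x, hxN, hx1⟩ := N.bot_or_exists_ne_one.resolve_left hN
  -- Commutators of `x` with Tⁿ lie in N ∩ Tⁿ; if all were trivial, `x` would centralize Tⁿ.
  obtain ⟨y, hyT, hyN, hy1⟩ : ∃ y ∈ power n T, base X n y ∈ N ∧ y ≠ 1 := by
    by_contra! h
    refine hx1 (hT.eq_one_of_centralizes fun t ht => ?_)
    obtain ⟨t', ht', he⟩ := hT.base_conj_mem x ht
    have h1 := hcomm x hxN t ht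
    rw [he, ← map_inv, ← map_mul] at h1
    have h2 := h _ ((power n T).mul_mem ht' ((power n T).inv_mem ht)) h1
    rw [he, mul_inv_eq_one.1 h2]
  obtain ⟨i, hi⟩ := Function.ne_iff.1 hy1
  let S : ZMod n → Subgroup T := fun i =>
    N.comap ((base X n).comp ((MonoidHom.mulSingle (fun _ : ZMod n => X) i).comp T.subtype))
  have hS : ∀ i (u : T), u ∈ S i ↔ base X n (Pi.mulSingle i (u : X)) ∈ N := fun i u => Iff.rfl
  -- `S i` is normal in the simple group T. It is nontrivial because the commutator of `y` with a
  -- vector supported at `i` is again supported at `i`, and some t ∈ T fails to commute with `y i`.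
  have hSi : S i = ⊤ := by
    have hnormal : (S i).Normal := ⟨fun u hu t => by
      rw [hS] at hu ⊢
      have := hNT _ (hsingle i t t.2) _ hu
      rw [← map_mul, ← map_inv, ← map_mul, ← Pi.mulSingle_mul, ← Pi.mulSingle_inv,
        ← Pi.mulSingle_mul] at this
      exact this⟩
    refine (hT.simple.eq_bot_or_eq_top_of_normal _ hnormal).resolve_left fun hbot => ?_
    obtain ⟨t, ht, hne⟩ := hT.exists_not_commute hi
    have h1 := hcomm _ hyN _ (hsingle i t ht)
    have h2 : y * Pi.mulSingle i t * y⁻¹ * (Pi.mulSingle i t)⁻¹ =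
        Pi.mulSingle i (y i * t * (y i)⁻¹ * t⁻¹) := by
      funext j
      by_cases hj : j = i
      · subst hj; simp
      · simp [Pi.mulSingle_eq_of_ne hj]
    rw [← map_mul, ← map_inv, ← map_mul, ← map_inv, ← map_mul, h2] at h1
    have hm : y i * t * (y i)⁻¹ * t⁻¹ ∈ T :=
      T.mul_mem (hT.normal.conj_mem t ht _) (T.inv_mem ht)
    have h3 : (⟨_, hm⟩ : T) ∈ S i := h1
    rw [hbot, Subgroup.mem_bot] at h3
    have h4 := congrArg Subtype.val h3
    have h5 : y i * t * (y i)⁻¹ * t⁻¹ = 1 := h4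
    exact hne (mul_inv_eq_iff_eq_mul.1 (mul_inv_eq_one.1 h5)).symm
  -- Conjugation by θ carries the factor at j + 1 to the factor at j, so going down cyclically from
  -- `i` reaches all factors.
  have hstep : ∀ j, S (j + 1) = ⊤ → S j = ⊤ := by
    intro j hj
    rw [Subgroup.eq_top_iff'] at hj ⊢
    intro u
    rw [hS]
    set d := dVec n b c j with hd
    have hm : d⁻¹ * u * d ∈ T := by simpa using hT.normal.conj_mem u u.2 d⁻¹
    have h1 := hNθ _ ((hS _ _).1 (hj ⟨_, hm⟩))
    rw [conj_base, theta_left, theta_right] at h1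
    convert h1 using 2
    funext k
    by_cases hk : k = j
    · subst hk
      simp only [toAdd_ofAdd, Pi.mulSingle_eq_same, ← hd]
      group
    · rw [Pi.mulSingle_eq_of_ne hk, toAdd_ofAdd,
        Pi.mulSingle_eq_of_ne (fun h => hk (add_right_cancel h))]
      group
  have hall : ∀ k : ℕ, S (i - k) = ⊤ := by
    intro k
    induction k with
    | zero => simpa using hSi
    | succ k ih => exact hstep _ (by rw [← ih]; congr 1; push_cast; ring)
  rw [Subgroup.map_le_iff_le_comap]
  intro t ht
  refine Subgroup.pi_mem_of_mulSingle_mem t fun j => ?_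
  obtain ⟨k, hk⟩ := ZMod.natCast_zmod_surjective (i - j)
  have hj : S j = ⊤ := by rw [← hall k, hk, sub_sub_cancel]
  have : (⟨t j, mem_power.1 ht j⟩ : T) ∈ S j := hj ▸ Subgroup.mem_top _
  exact this

end Socle

end Wreath

/-- Only normalization of K by L is needed, not normality of K in the whole group; this serves E⟨θ⟩,
Tⁿ⟨θ⟩ and R = F(⟨b⟩⟨c⟩). -/
theorem exists_mul_of_mem_sup {W : Type*} [Group W] {K L : Subgroup W}
    (hL : L ≤ Subgroup.normalizer (K : Set W)) {w : W} (hw : w ∈ K ⊔ L) :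
    ∃ x ∈ K, ∃ y ∈ L, x * y = w := by
  have hn : (K.subgroupOf (K ⊔ L)).Normal :=
    Subgroup.normal_subgroupOf_of_le_normalizer (sup_le Subgroup.le_normalizer hL)
  have htop : K.subgroupOf (K ⊔ L) ⊔ L.subgroupOf (K ⊔ L) = ⊤ := by
    rw [← Subgroup.subgroupOf_sup le_sup_left le_sup_right, Subgroup.subgroupOf_self]
  have h : (⟨w, hw⟩ : ↥(K ⊔ L)) ∈ K.subgroupOf (K ⊔ L) ⊔ L.subgroupOf (K ⊔ L) :=
    htop ▸ Subgroup.mem_top _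
  obtain ⟨x, hx, y, hy, hxy⟩ := Subgroup.mem_sup_of_normal_left.1 h
  exact ⟨x, hx, y, hy, congrArg Subtype.val hxy⟩

/-! ### Quasiprimitivity and product action type on cosets -/

section Permutation

variable {G : Type u} [Group G] {M H : Subgroup G}

theorem isUniqueMinimalNormal_of_forall_le (hMn : M.Normal) (hM1 : M ≠ ⊥)
    (hM : ∀ K : Subgroup G, K.Normal → K ≠ ⊥ → M ≤ K) : IsUniqueMinimalNormal M := by
  refine ⟨⟨⟨hMn, hM1⟩, fun K hK _ => hM K hK.1 hK.2⟩, fun K hK => ?_⟩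
  exact le_antisymm (hK.2 ⟨hMn, hM1⟩ (hM K hK.1.1 hK.1.2)) (hM K hK.1.1 hK.1.2)

/-- The core of H is trivial, since otherwise it would contain M. A nontrivial normal subgroup
contains M, which is already transitive. -/
theorem isQuasiprimitive_quotient_of_forall_le
    (hM : ∀ K : Subgroup G, K.Normal → K ≠ ⊥ → M ≤ K) (hMH : ¬ M ≤ H)
    (htop : ∀ g : G, ∃ m ∈ M, (m : G ⧸ H) = g) : IsQuasiprimitive G (G ⧸ H) := by
  refine ⟨⟨((1 : G) : G ⧸ H)⟩, ?_, ?_⟩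
  · have hK : H.normalCore = ⊥ := by
      by_contra hK
      exact hMH ((hM _ H.normalCore_normal hK).trans H.normalCore_le)
    rw [Subgroup.normalCore_eq_ker, MonoidHom.ker_eq_bot_iff] at hK
    exact ⟨fun {a b} h => hK (Equiv.ext h)⟩
  · refine ⟨fun {N} hN hfix => ?_⟩
    have hN1 : N ≠ ⊥ := by
      rintro rfl
      refine hfix (Set.eq_univ_of_forall fun x g => ?_)
      have : g = 1 := Subsingleton.elim _ _
      rw [this]
      exact one_smul G x
    have hMN := hM N hN hN1
    have key : ∀ x : G ⧸ H, ∃ g : N, g • ((1 : G) : G ⧸ H) = x := by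
      intro x
      obtain ⟨g, rfl⟩ := QuotientGroup.mk_surjective x
      obtain ⟨m, hm, hmg⟩ := htop g
      refine ⟨⟨m, hMN hm⟩, ?_⟩
      rw [← hmg]
      change ((m * 1 : G) : G ⧸ H) = m
      rw [mul_one]
    exact ⟨fun x y => by
      obtain ⟨g, rfl⟩ := key x
      obtain ⟨h, rfl⟩ := key y
      refine ⟨h * g⁻¹, ?_⟩
      change ((h : G) * (g : G)⁻¹) • (g : G) • ((1 : G) : G ⧸ H) = (h : G) • ((1 : G) : G ⧸ H)
      rw [mul_smul, inv_smul_smul]⟩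

variable {n : ℕ} {S : Type u} [Group S] (e : M ≃* (Fin n → S))

/-- The stabilizer of the coset mH is mHm⁻¹. -/
theorem mem_stabInProduct_mk (m : M) (y : Fin n → S) :
    y ∈ stabInProduct e ((m : G) : G ⧸ H) ↔
      (e m)⁻¹ * y * e m ∈ (H.subgroupOf M).map e.toMonoidHom := by
  have hmem : ∀ (K : Subgroup G) (y : Fin n → S),
      y ∈ (K.subgroupOf M).map e.toMonoidHom ↔ ((e.symm y : M) : G) ∈ K := by
    intro K y
    constructor
    · rintro ⟨x, hx, rfl⟩
      have hx' : (x : G) ∈ K := hx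
      simpa using hx'
    · intro h
      exact ⟨e.symm y, h, e.apply_symm_apply y⟩
  rw [stabInProduct, hmem, hmem, MulAction.mem_stabilizer_iff]
  have h1 : (((e.symm y : M) : G) • ((m : G) : G ⧸ H)) = ((((e.symm y : M) : G) * m : G) : G ⧸ H) :=
    rfl
  rw [h1, eq_comm, QuotientGroup.eq]
  simp [mul_assoc]

variable {e}

/-- By transitivity of M every point is mH with m ∈ M, so its stabilizer in M is conjugate under m
to that of H. The required factors are the conjugates of Q by the coordinates of `e m`. -/
theorem isPADecomposition_quotient (hn : 2 ≤ n) (hS : IsSimpleGroup S)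
    (hS' : ¬ ∀ x y : S, x * y = y * x) {Q : Subgroup S} (hQ : Q ≠ ⊥) (hQ' : Q ≠ ⊤)
    (htop : ∀ g : G, ∃ m ∈ M, (m : G ⧸ H) = g)
    (hsub : IsSubdirect ((H.subgroupOf M).map e.toMonoidHom) fun _ => Q) :
    IsPADecomposition (G ⧸ H) e where
  two_le := hn
  simple := fun _ => hS
  nonabelian := fun _ => hS'
  isomorphic := fun _ _ => ⟨MulEquiv.refl _⟩
  subdirect := by
    intro α
    obtain ⟨g, rfl⟩ := QuotientGroup.mk_surjective α
    obtain ⟨m, hm, hmg⟩ := htop g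
    rw [← hmg]
    let φ : Fin n → S ≃* S := fun i => MulAut.conj (e ⟨m, hm⟩ i)
    refine ⟨fun i => Q.map (φ i).toMonoidHom, fun i => ⟨?_, ?_⟩, fun i j => ?_, fun i => ?_⟩
    · rwa [Ne, Subgroup.map_eq_bot_iff_of_injective _ (φ i).injective]
    · refine lt_top_iff_ne_top.2 fun h => hQ' ?_
      rw [Subgroup.eq_top_iff'] at h ⊢
      intro x
      obtain ⟨y, hy, hyx⟩ := h (φ i x)
      rwa [← (φ i).injective hyx]
    · exact ⟨((φ i).subgroupMap Q).symm.trans ((φ j).subgroupMap Q)⟩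
    · ext y
      constructor
      · rintro ⟨x, hx, rfl⟩
        refine ⟨(e ⟨m, hm⟩ i)⁻¹ * x i * e ⟨m, hm⟩ i, ?_, ?_⟩
        · have h := (mem_stabInProduct_mk e ⟨m, hm⟩ x).1 hx
          exact (hsub i).le ⟨_, h, rfl⟩
        · change e ⟨m, hm⟩ i * ((e ⟨m, hm⟩ i)⁻¹ * x i * e ⟨m, hm⟩ i) * (e ⟨m, hm⟩ i)⁻¹ = x i
          group
      · rintro ⟨x, hx, rfl⟩
        obtain ⟨z, hz, rfl⟩ := (hsub i).ge hx
        refine ⟨e ⟨m, hm⟩ * z * (e ⟨m, hm⟩)⁻¹, ?_, rfl⟩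
        refine (mem_stabInProduct_mk e ⟨m, hm⟩ _).2 ?_
        rwa [show (e ⟨m, hm⟩)⁻¹ * (e ⟨m, hm⟩ * z * (e ⟨m, hm⟩)⁻¹) * e ⟨m, hm⟩ = z by group]

theorem not_isDiagonalAt_quotient (htop : ∀ g : G, ∃ m ∈ M, (m : G ⧸ H) = g) {x : Fin n → S}
    (hx : x ∈ (H.subgroupOf M).map e.toMonoidHom) (hx1 : x ≠ 1) {i : Fin n} (hxi : x i = 1)
    (α : G ⧸ H) : ¬ IsDiagonalAt e α := by
  intro hd
  obtain ⟨g, rfl⟩ := QuotientGroup.mk_surjective α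
  obtain ⟨m, hm, hmg⟩ := htop g
  rw [← hmg] at hd
  have hmem : e ⟨m, hm⟩ * x * (e ⟨m, hm⟩)⁻¹ ∈ stabInProduct e ((m : G) : G ⧸ H) := by
    refine (mem_stabInProduct_mk e ⟨m, hm⟩ _).2 ?_
    convert hx using 1
    group
  have h := hd i hmem (Subgroup.one_mem _) (by simp [hxi])
  exact hx1 (by simpa using h)

end Permutation

/-! ### Tⁿ as a direct product, and commutators landing in Tⁿ -/

section Wreath

variable {X : Type u} [Group X] {n : ℕ}

theorem exists_mulEquiv_pi_of_power [NeZero n] (T : Subgroup X) {G : Subgroup (CyclicWreath X n)}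
    (hG : (power n T).map (base X n) ≤ G) :
    ∃ (e : ((power n T).map (base X n)).subgroupOf G ≃* (Fin n → T)) (φ : Fin n ≃ ZMod n),
      ∀ x i, ((e x i : T) : X) = (x : CyclicWreath X n).left (φ i) := by
  let φ : Fin n ≃ ZMod n := (ZMod.finEquiv n).toEquiv
  have hx : ∀ x : Fin n → T, (fun j => (x (φ.symm j) : X)) ∈ power n T := fun x =>
    mem_power.2 fun j => (x (φ.symm j)).2
  let ψ : (Fin n → T) →* ((power n T).map (base X n)).subgroupOf G :=
    { toFun := fun x => ⟨⟨base X n fun j => (x (φ.symm j) : X),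
        hG (base_mem_map.2 (hx x))⟩, base_mem_map.2 (hx x)⟩
      map_one' := rfl
      map_mul' := fun x y => by
        apply Subtype.ext; apply Subtype.ext
        exact map_mul (base X n) (fun j => (x (φ.symm j) : X)) (fun j => (y (φ.symm j) : X)) }
  have hψ : ∀ x i, (ψ x : CyclicWreath X n).left (φ i) = x i := fun x i => by
    change (x (φ.symm (φ i)) : X) = x i
    rw [Equiv.symm_apply_apply]
  have hbij : Function.Bijective ψ := by
    constructor
    · intro x y h
      funext i
      apply Subtype.ext
      rw [← hψ, ← hψ, h]
    · rintro ⟨⟨w, hw⟩, hw'⟩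
      obtain ⟨t, ht, htw⟩ := Subgroup.mem_map.1 (show w ∈ (power n T).map (base X n) from hw')
      refine ⟨fun i => ⟨t (φ i), mem_power.1 ht _⟩, ?_⟩
      apply Subtype.ext; apply Subtype.ext
      change base X n (fun j => t (φ (φ.symm j))) = w
      rw [← htw]
      simp
  refine ⟨(MulEquiv.ofBijective ψ hbij).symm, φ, fun x i => ?_⟩
  obtain ⟨y, rfl⟩ := hbij.2 x
  rw [hψ]
  exact congrArg (fun z : Fin n → T => (z i : X))
    ((MulEquiv.ofBijective ψ hbij).symm_apply_apply y)

theorem theta_mem_normalizer_power {T : Subgroup X} (hT : T.Normal) (w : CyclicWreath X n) :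
    w ∈ Subgroup.normalizer (((power n T).map (base X n) : Subgroup _) : Set (CyclicWreath X n)) := by
  have h : ((power n T).map (base X n)).Normal := ⟨by
    rintro _ ⟨t, ht, rfl⟩ w
    rw [conj_base]
    exact base_mem_map.2 (mem_power.2 fun i => hT.conj_mem _ (mem_power.1 ht _) _)⟩
  rw [Subgroup.normalizer_eq_top_iff.2 h]
  trivial

theorem conj_mul_inv_mem_of_index_le_two {T : Subgroup X} [Finite X] (hT : T.index ≤ 2) (x y : X) :
    x * y * x⁻¹ * y⁻¹ ∈ T := by
  have h0 : T.index ≠ 0 := T.index_ne_zero_of_finite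
  obtain h | h : T.index = 1 ∨ T.index = 2 := by omega
  · rw [Subgroup.index_eq_one.1 h]; trivial
  · simp only [Subgroup.mul_mem_iff_of_index_two h, inv_mem_iff]
    tauto

/-- If conjugation by `(l, …, l)` normalizes `E` and fixes no nontrivial element of `E`, then every
element of `E` is a commutator with `(l, …, l)`, and so lies in `Tⁿ`. -/
theorem le_power_of_free [Finite X] {T : Subgroup X} (hT : T.index ≤ 2)
    {E : Subgroup (ZMod n → X)} [Finite E] {l : X} (hl : ∀ x ∈ E, (fun i => l * x i * l⁻¹) ∈ E)
    (hfree : ∀ x ∈ E, (∀ i, l * x i * l⁻¹ = x i) → x = 1) : E ≤ power n T := by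
  -- This is x ↦ [(l, …, l), x]. Equal values at x and y mean that y⁻¹x is fixed by (l, …, l), so
  -- `ψ` is injective and, E being finite, surjective.
  let ψ : E → E := fun x =>
    ⟨(fun i => l * x.1 i * l⁻¹) * x.1⁻¹, E.mul_mem (hl _ x.2) (E.inv_mem x.2)⟩
  have hψ : Function.Injective ψ := by
    intro x y h
    have h1 : ∀ i, l * x.1 i * l⁻¹ * (x.1 i)⁻¹ = l * y.1 i * l⁻¹ * (y.1 i)⁻¹ := fun i =>
      congrFun (congrArg Subtype.val h) i
    have h2 := hfree (y.1⁻¹ * x.1) (E.mul_mem (E.inv_mem y.2) x.2) fun i => by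
      have h3 : l * x.1 i * l⁻¹ = l * y.1 i * l⁻¹ * (y.1 i)⁻¹ * x.1 i := by
        rw [← h1 i, inv_mul_cancel_right]
      calc l * ((y.1 i)⁻¹ * x.1 i) * l⁻¹
          = (l * y.1 i * l⁻¹)⁻¹ * (l * x.1 i * l⁻¹) := by group
        _ = (y.1 i)⁻¹ * x.1 i := by rw [h3]; group
    exact Subtype.ext (inv_mul_eq_one.1 h2).symm
  intro x hx
  obtain ⟨y, hy⟩ := (Finite.injective_iff_surjective.1 hψ) ⟨x, hx⟩
  have hxy : (fun i => l * y.1 i * l⁻¹) * y.1⁻¹ = x := congrArg Subtype.val hy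
  rw [← hxy]
  exact mem_power.2 fun i => conj_mul_inv_mem_of_index_le_two hT l (y.1 i)

/-- A nonabelian simple group is not contained in a group with a nontrivial abelian normal
subgroup contained in it. -/
theorem ProductAction.IsAlmostSimpleWithSocle.not_le {T : Subgroup X}
    (hT : IsAlmostSimpleWithSocle T) {R F : Subgroup X} (hFT : F ≤ T) (hF1 : F ≠ ⊥)
    (hF : ∀ x ∈ F, ∀ y ∈ F, x * y = y * x) (hR : R ≤ Subgroup.normalizer (F : Set X)) : ¬ T ≤ R := by
  intro hTR
  have hn : (F.subgroupOf T).Normal := Subgroup.normal_subgroupOf_of_le_normalizer (hTR.trans hR)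
  rcases hT.simple.eq_bot_or_eq_top_of_normal _ hn with h | h
  · rw [Subgroup.subgroupOf_eq_bot, disjoint_iff, inf_eq_left.2 hFT] at h
    exact hF1 h
  · have hTF : T ≤ F := Subgroup.subgroupOf_eq_top.1 h
    exact hT.nonabelian fun x y => Subtype.ext (hF x (hTF x.2) y (hTF y.2))

end Wreath

/-! ### The main theorem -/

theorem mainTheorem5
    -- the arithmetical condition on `q = p ^ f` and `n = q + 1`
    (p f q n s t r : ℕ) [Fact p.Prime] (hf : 1 ≤ f) (hq : q = p ^ f) (hn : n = q + 1)
    (hr : r.Prime) (hr2 : r ≠ 2) (hnst : n = 2 ^ s * r ^ t) (hn3 : 3 < n)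
    (hs : 2 ≤ s ∨ Even q)
    -- the almost simple group `X` with socle `T`
    {X : Type u} [Group X] [Finite X] (T : Subgroup X)
    (hT : IsAlmostSimpleWithSocle T) (hTX : T.index ≤ 2)
    -- the subgroup `R = F:(⟨b⟩ × ⟨c⟩)` isomorphic to `AGL₁(q)`
    (R F : Subgroup X) (b c : X)
    (hR : Nonempty (R ≃* AGL1 (GaloisField p f)))
    (hFp : Nonempty (F ≃* Multiplicative (Fin f → ZMod p)))
    (hb : orderOf b = (q - 1) / Nat.gcd 2 (q - 1)) (hc : orderOf c = Nat.gcd 2 (q - 1))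
    (hbc : b * c = c * b) (hbc' : Subgroup.zpowers b ⊓ Subgroup.zpowers c = ⊥)
    (hFR : F ⊔ (Subgroup.zpowers b ⊔ Subgroup.zpowers c) = R)
    (hFn : (F.subgroupOf R).Normal)
    (hFc : F ⊓ (Subgroup.zpowers b ⊔ Subgroup.zpowers c) = ⊥)
    -- the minimal normal subgroup `E` of `Fⁿ:⟨θ⟩`
    (E : Subgroup (ZMod n → X)) (hEF : E ≤ power n F)
    (hEmin : IsMinimalNormal ((E.map (base X n)).subgroupOf (extendByTheta n b c (power n F))))
    (hE1 : Nonempty (E ≃* Multiplicative (Fin (2 * f) → ZMod p)))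
    (hE2 : ∀ x ∈ E, ∀ y ∈ E, x ≠ 1 → y ≠ 1 →
      ∃ g ∈ Subgroup.zpowers (theta n b c), g⁻¹ * base X n x * g = base X n y)
    (hE3 : ∀ i, E.map (Pi.evalMonoidHom (fun _ : ZMod n => X) i) = F)
    (hE3' : ∀ i j, i ≠ j → (Pi.evalMonoidHom (fun _ : ZMod n => X) i).ker ⊓ E ≠
      (Pi.evalMonoidHom (fun _ : ZMod n => X) j).ker ⊓ E)
    -- the groups `G = Tⁿ⟨θ⟩` and `H = E:⟨θ⟩`
    (G H : Subgroup (CyclicWreath X n))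
    (hG : G = extendByTheta n b c (power n T)) (hH : H = extendByTheta n b c E) :
    H ≤ G ∧
    E.map (base X n) ⊓ Subgroup.zpowers (theta n b c) = ⊥ ∧
    Nonempty (H ≃* AGL1 (GaloisField p (2 * f))) ∧
    IsQuasiprimitiveOfNonDiagonalPAType G (G ⧸ H.subgroupOf G) ∧
    IsUniqueMinimalNormal (((power n T).map (base X n)).subgroupOf G) ∧
    IsSubdirect (power n T ⊓ H.comap (base X n)) (fun _ => R ⊓ T) := by

  classical
  have hp : p.Prime := Fact.out
  have hNZ : NeZero n := ⟨by omega⟩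
  have hq3 : 3 ≤ q := by omega
  have hgdvd : Nat.gcd 2 (q - 1) ∣ q - 1 := Nat.gcd_dvd_right _ _
  -- This is q² − 1 = (q + 1)(q − 1).
  have hcardpow : p ^ (2 * f) = n * (q - 1) + 1 := by
    rw [mul_comm 2 f, pow_mul, ← hq, hn]
    obtain ⟨k, rfl⟩ : ∃ k, q = k + 1 := ⟨q - 1, by omega⟩
    simp only [Nat.add_sub_cancel]
    ring
  have hN : p ^ (2 * f) - 1 = n * (q - 1) := by omega
  have hN0 : 0 < n * (q - 1) := Nat.mul_pos (by omega) (by omega)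
  set θ := theta n b c with hθ
  set D := Subgroup.zpowers b ⊔ Subgroup.zpowers c with hD
  obtain ⟨hDcomm, hDexp, hDcard, hbD, hcD⟩ := zpowers_sup_zpowers_of_commute hbc (N := q - 1)
    (by rw [hb]; exact Nat.div_dvd_of_dvd hgdvd) (by rw [hc]; exact hgdvd)
  rw [hb, hc, Nat.div_mul_cancel hgdvd] at hDcard
  obtain ⟨l, hlD, hl⟩ := theta_pow_eq_base_const (n := n) hDcomm hbD hcD
  rw [← hθ] at hl
  -- the group `E⟨θ⟩`
  have hcardE : Nat.card E = p ^ (2 * f) := card_of_mulEquiv_pi_zmod hE1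
  have hE1' : Nonempty (E.map (base X n) ≃* Multiplicative (Fin (2 * f) → ZMod p)) :=
    hE1.map fun e => (E.equivMapOfInjective _ base_injective).symm.trans e
  have hcardE' : Nat.card (E.map (base X n)) = n * (q - 1) + 1 := by
    rw [card_of_mulEquiv_pi_zmod hE1', hcardpow]
  have hEnorm : Subgroup.zpowers θ ≤
      Subgroup.normalizer ((E.map (base X n) : Subgroup _) : Set (CyclicWreath X n)) := by
    have hle : E.map (base X n) ≤ extendByTheta n b c (power n F) :=
      (Subgroup.map_mono hEF).trans le_sup_left
    exact le_sup_right.trans ((Subgroup.normal_subgroupOf_iff_le_normalizer hle).1 hEmin.1.1)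
  have hθpow : θ ^ (n * (q - 1)) = 1 := by
    rw [pow_mul, hl, ← map_pow]
    have : (fun _ : ZMod n => l) ^ (q - 1) = 1 := funext fun _ => hDexp l hlD
    rw [this, map_one]
  have htrans : ∀ x ∈ E.map (base X n), ∀ y ∈ E.map (base X n), x ≠ 1 → y ≠ 1 →
      ∃ g ∈ Subgroup.zpowers θ, g * x * g⁻¹ = y := by
    rintro _ ⟨x, hx, rfl⟩ _ ⟨y, hy, rfl⟩ hx1 hy1
    obtain ⟨g, hg, h⟩ := hE2 x hx y hy (fun h => hx1 (by rw [h, map_one]))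
      (fun h => hy1 (by rw [h, map_one]))
    exact ⟨g⁻¹, inv_mem hg, by rwa [inv_inv]⟩
  obtain ⟨hord, hfree⟩ := zpow_eq_one_of_transitive hcardE' hN0 hθpow htrans
  have hEH : E.map (base X n) ≤ H := hH ▸ le_sup_left
  have hθH : θ ∈ H := hH ▸ Subgroup.mem_sup_right (Subgroup.mem_zpowers θ)
  have hAGL : E.map (base X n) ⊓ Subgroup.zpowers θ = ⊥ ∧
      Nonempty (H ≃* AGL1 (GaloisField p (2 * f))) := by
    have hn' : ((E.map (base X n)).subgroupOf H).Normal :=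
      Subgroup.normal_subgroupOf_of_le_normalizer (by
        rw [hH]; exact sup_le Subgroup.le_normalizer hEnorm)
    have hz : Subgroup.zpowers (⟨θ, hθH⟩ : H) = (Subgroup.zpowers θ).subgroupOf H := by
      apply Subgroup.map_injective H.subtype_injective
      rw [MonoidHom.map_zpowers, Subgroup.map_subgroupOf_eq_of_le (by simpa using hθH)]
      rfl
    obtain ⟨h1, h2⟩ := nonempty_mulEquiv_AGL1_of_transitive (p := p) (m := 2 * f) (by omega)
      (A := (E.map (base X n)).subgroupOf H) (z := ⟨θ, hθH⟩)
      (hE1'.map fun e => (Subgroup.subgroupOfEquivOfLe hEH).trans e)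
      (by
        rw [hz, ← Subgroup.subgroupOf_sup hEH (by simpa using hθH), Subgroup.subgroupOf_eq_top, hH]
        exact le_rfl)
      (Subtype.ext (by rw [hN]; exact hθpow))
      (by
        intro x hx y hy hx1 hy1
        obtain ⟨g, hg, h⟩ := htrans x hx y hy (fun h => hx1 (Subtype.ext h))
          (fun h => hy1 (Subtype.ext h))
        refine ⟨⟨g, (Subgroup.zpowers_le.2 hθH) hg⟩, ?_, Subtype.ext h⟩
        rw [hz]
        exact hg)
    refine ⟨?_, h2⟩
    rw [hz] at h1
    rw [Subgroup.eq_bot_iff_forall]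
    rintro x ⟨hx, hx'⟩
    have : (⟨x, hEH hx⟩ : H) ∈ (⊥ : Subgroup H) := h1 ▸ ⟨hx, hx'⟩
    exact congrArg Subtype.val (Subgroup.mem_bot.1 this)
  -- `l` generates `⟨b⟩ × ⟨c⟩`
  have hlzpow : ∀ j : ℤ, (θ ^ n) ^ j = base X n fun _ => l ^ j := by
    intro j
    rw [hl, ← map_zpow]
    rfl
  -- θ has order n(q − 1), which divides n times the order of l; so l has order at least q − 1,
  -- while |D| ≤ q − 1.
  have hlD' : Subgroup.zpowers l = D := by
    refine Subgroup.eq_of_le_of_card_ge (Subgroup.zpowers_le.2 hlD) (hDcard.trans ?_)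
    rw [Nat.card_zpowers]
    have h1 : θ ^ (n * orderOf l) = 1 := by
      rw [pow_mul, ← zpow_natCast, hlzpow, zpow_natCast, pow_orderOf_eq_one]
      exact map_one (base X n)
    have h2 := orderOf_dvd_of_pow_eq_one h1
    rw [hord] at h2
    exact Nat.le_of_mul_le_mul_left (Nat.le_of_dvd
      (Nat.mul_pos (by omega) (orderOf_pos l)) h2) (by omega : 0 < n)
  -- `F ≤ T`
  have hET : E ≤ power n T := by
    have hconj : ∀ x, θ ^ n * base X n x * (θ ^ n)⁻¹ = base X n fun i => l * x i * l⁻¹ := by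
      intro x
      rw [hl, ← map_mul, ← map_inv, ← map_mul]
      rfl
    have hmem : θ ^ n ∈ Subgroup.zpowers θ := ⟨n, zpow_natCast θ n⟩
    refine le_power_of_free hTX (l := l) (fun x hx => ?_) (fun x hx h => ?_)
    · have h := (Subgroup.mem_normalizer_iff.1 (hEnorm hmem) (base X n x)).1 (base_mem_map.2 hx)
      rw [hconj] at h
      exact base_mem_map.1 h
    · by_contra hx1
      have h1 := hfree _ hmem _ (base_mem_map.2 hx)
        (fun h' => hx1 (base_injective (h'.trans (map_one _).symm)))
        (by rw [hconj]; exact congrArg _ (funext h))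
      -- θⁿ ≠ 1 because q ≥ 3 makes the order n(q − 1) of θ at least 2n.
      have h2 := Nat.le_of_dvd (by omega) (orderOf_dvd_of_pow_eq_one h1)
      rw [hord] at h2
      have h3 : n * 2 ≤ n * (q - 1) := Nat.mul_le_mul_left n (by omega)
      omega
  have hFT : F ≤ T := by
    intro x hx
    rw [← hE3 0] at hx
    obtain ⟨e, he, rfl⟩ := hx
    exact mem_power.1 (hET he) 0
  have hHG : H ≤ G := by
    rw [hH, hG]
    exact sup_le_sup_right (Subgroup.map_mono hET) _
  -- the intersection of `H` with the base group
  have hFRle : F ≤ R := hFR ▸ le_sup_left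
  have hDR : D ≤ R := hFR ▸ le_sup_right
  have hRnorm : R ≤ Subgroup.normalizer (F : Set X) :=
    (Subgroup.normal_subgroupOf_iff_le_normalizer hFRle).1 hFn
  have hHbase : ∀ y, base X n y ∈ H → ∃ e ∈ E, ∃ j : ℤ, y = e * fun _ => l ^ j := by
    intro y hy
    rw [hH] at hy
    obtain ⟨_, ⟨e, he, rfl⟩, _, ⟨k, rfl⟩, h⟩ := exists_mul_of_mem_sup hEnorm hy
    have hr := congrArg SemidirectProduct.right h
    -- An element eθᵏ lies in the base group only if n divides k, so θᵏ is a power of (l, …, l).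
    simp only [SemidirectProduct.mul_right, SemidirectProduct.right_inl, one_mul] at hr
    rw [theta_zpow_right, ofAdd_eq_one, ZMod.intCast_zmod_eq_zero_iff_dvd] at hr
    obtain ⟨j, rfl⟩ := hr
    refine ⟨e, he, j, base_injective ?_⟩
    rw [map_mul, ← hlzpow, ← zpow_natCast, ← zpow_mul]
    exact h.symm
  have hEHbase : ∀ e ∈ E, ∀ j : ℤ, base X n (e * fun _ => l ^ j) ∈ H := by
    intro e he j
    rw [map_mul, ← hlzpow]
    exact H.mul_mem (hEH (base_mem_map.2 he)) (H.zpow_mem (H.pow_mem hθH n) j)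
  have hsub : IsSubdirect (power n T ⊓ H.comap (base X n)) (fun _ => R ⊓ T) := by
    intro i
    apply le_antisymm
    · rintro _ ⟨y, ⟨hyT, hyH⟩, rfl⟩
      refine ⟨?_, mem_power.1 hyT i⟩
      obtain ⟨e, he, j, rfl⟩ := hHbase y hyH
      exact R.mul_mem (hFRle (mem_power.1 (hEF he) i)) (hDR (D.zpow_mem hlD j))
    · rintro x ⟨hxR, hxT⟩
      rw [← hFR] at hxR
      obtain ⟨y, hy, d, hd, rfl⟩ := exists_mul_of_mem_sup (hDR.trans hRnorm) hxR
      have hyT : y ∈ T := hFT hy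
      rw [← hE3 i] at hy
      obtain ⟨e, he, rfl⟩ := hy
      rw [← hlD'] at hd
      obtain ⟨j, rfl⟩ := hd
      -- The F-part lies in T, so the remaining factor does too, and the constant vector with that
      -- entry lies in Tⁿ.
      have hlT : l ^ j ∈ T := (T.mul_mem_cancel_left hyT).1 hxT
      exact ⟨e * fun _ => l ^ j, ⟨(power n T).mul_mem (hET he) (mem_power.2 fun _ => hlT),
        hEHbase e he j⟩, rfl⟩
  have hFcard : Nat.card F = p ^ f := card_of_mulEquiv_pi_zmod hFp
  have hF1 : F ≠ ⊥ := by
    obtain ⟨x, hx, hx1⟩ := exists_mem_ne_one_of_card (hFcard.trans hq.symm) (by omega)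
    exact fun h => hx1 (Subgroup.mem_bot.1 (h ▸ hx))
  have hTR : ¬ T ≤ R := hT.not_le hFT hF1
    (fun x hx y hy => commute_of_mulEquiv_multiplicative hFp hx hy) hRnorm
  -- the minimal normal subgroup `Tⁿ` of `G`
  have hMG : (power n T).map (base X n) ≤ G := hG ▸ le_sup_left
  have hθG : θ ∈ G := hHG hθH
  set M := ((power n T).map (base X n)).subgroupOf G with hM
  have hMn : M.Normal := Subgroup.normal_subgroupOf_of_le_normalizer
    fun w _ => theta_mem_normalizer_power hT.normal w
  have hMle : ∀ K : Subgroup G, K.Normal → K ≠ ⊥ → M ≤ K := by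
    intro K hK hK1
    have hconj : ∀ g ∈ G, ∀ x ∈ K.map G.subtype, g * x * g⁻¹ ∈ K.map G.subtype := by
      rintro g hg _ ⟨x, hx, rfl⟩
      exact ⟨_, hK.conj_mem x hx ⟨g, hg⟩, rfl⟩
    have h := hT.power_le_of_normalized (n := n) (b := b) (c := c) (N := K.map G.subtype)
      (by rwa [Ne, Subgroup.map_eq_bot_iff_of_injective _ G.subtype_injective])
      (fun t ht => hconj _ (hMG (base_mem_map.2 ht))) (hconj θ hθG)
    intro x hx
    obtain ⟨y, hy, hyx⟩ := h hx
    rwa [← Subtype.ext hyx]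
  have hM1 : M ≠ ⊥ := by
    intro h
    obtain ⟨t, ht, ht1⟩ := hT.exists_mem_ne_one
    have hmem : base X n (fun _ => t) ∈ (power n T).map (base X n) :=
      base_mem_map.2 (mem_power.2 fun _ => ht)
    have h1 : (⟨_, hMG hmem⟩ : G) ∈ M := hmem
    rw [h, Subgroup.mem_bot] at h1
    have h2 : base X n (fun _ => t) = base X n 1 := congrArg Subtype.val h1
    exact ht1 (congrFun (base_injective h2) 0)
  have hMuniq : IsUniqueMinimalNormal M := isUniqueMinimalNormal_of_forall_le hMn hM1 hMle
  have htop : ∀ g : G, ∃ m ∈ M, (m : G ⧸ H.subgroupOf G) = g := by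
    rintro ⟨g, hg⟩
    have hg' := hg
    rw [hG] at hg'
    obtain ⟨t, ht, z, hz, rfl⟩ := exists_mul_of_mem_sup
      (fun w _ => theta_mem_normalizer_power hT.normal w) hg'
    refine ⟨⟨t, hMG ht⟩, ht, QuotientGroup.eq.2 ?_⟩
    change t⁻¹ * (t * z) ∈ H
    rw [inv_mul_cancel_left]
    exact Subgroup.zpowers_le.2 hθH hz
  have hMH : ¬ M ≤ H.subgroupOf G := by
    intro h
    apply hTR
    intro t ht
    have hmem : base X n (fun _ => t) ∈ (power n T).map (base X n) :=
      base_mem_map.2 (mem_power.2 fun _ => ht)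
    have h1 : base X n (fun _ => t) ∈ H := h (show (⟨_, hMG hmem⟩ : G) ∈ M from hmem)
    exact ((hsub 0).le ⟨_, ⟨mem_power.2 fun _ => ht, h1⟩, rfl⟩).1
  -- the product action structure
  obtain ⟨e, φ, he⟩ := exists_mulEquiv_pi_of_power T hMG
  have hstab : ∀ y : ZMod n → X, y ∈ power n T → base X n y ∈ H →
      ∃ x ∈ ((H.subgroupOf G).subgroupOf M).map e.toMonoidHom, ∀ i, (x i : X) = y (φ i) := by
    intro y hyT hyH
    exact ⟨_, ⟨⟨⟨base X n y, hHG hyH⟩, base_mem_map.2 hyT⟩, hyH, rfl⟩, fun i => he _ i⟩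
  have hPAsub : IsSubdirect (((H.subgroupOf G).subgroupOf M).map e.toMonoidHom)
      fun _ => R.subgroupOf T := by
    intro i
    apply le_antisymm
    · rintro _ ⟨_, ⟨⟨⟨w, hwG⟩, hwM⟩, hwH, rfl⟩, rfl⟩
      obtain ⟨y, hy, rfl⟩ := Subgroup.mem_map.1 (show w ∈ (power n T).map (base X n) from hwM)
      have h : (e ⟨⟨base X n y, hwG⟩, hwM⟩ i : X) ∈ R := by
        rw [he]
        exact ((hsub (φ i)).le ⟨y, ⟨hy, hwH⟩, rfl⟩).1
      exact h
    · intro t ht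
      obtain ⟨y, ⟨hyT, hyH⟩, hyt⟩ := (hsub (φ i)).ge
        (show (t : X) ∈ R ⊓ T from ⟨ht, t.2⟩)
      obtain ⟨x, hx, hxy⟩ := hstab y hyT hyH
      exact ⟨x, hx, Subtype.ext ((hxy i).trans hyt)⟩
  have hPA : IsPADecomposition (G ⧸ H.subgroupOf G) e := by
    refine isPADecomposition_quotient (by omega) hT.simple hT.nonabelian
      (Q := R.subgroupOf T) ?_ (fun h => hTR (Subgroup.subgroupOf_eq_top.1 h)) htop hPAsub
    intro h
    rw [Subgroup.subgroupOf_eq_bot, Subgroup.disjoint_def] at h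
    exact hF1 ((Subgroup.eq_bot_iff_forall F).2 fun x hx => h (hFRle hx) (hFT hx))
  -- Otherwise the projection at coordinate 0 would embed E, of order p ^ (2f), in F, of order p ^
  -- f.
  obtain ⟨x, hxE, hx0, hx1⟩ : ∃ x ∈ E, x 0 = 1 ∧ x ≠ 1 := by
    by_contra! h
    have hinj : Function.Injective (fun x : E => (⟨x.1 0, mem_power.1 (hEF x.2) 0⟩ : F)) := by
      intro x y hxy
      have h0 : x.1 0 = y.1 0 := congrArg Subtype.val hxy
      exact Subtype.ext (inv_mul_eq_one.1 (h _ (E.mul_mem (E.inv_mem x.2) y.2) (by simp [h0])))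
    have hle := Nat.card_le_card_of_injective _ hinj
    rw [hcardE, hFcard] at hle
    exact absurd hle (not_le.2 (Nat.pow_lt_pow_right hp.one_lt (by omega)))
  obtain ⟨y, hy, hyx⟩ := hstab x (hET hxE) (hEH (base_mem_map.2 hxE))
  refine ⟨hHG, hAGL.1, hAGL.2, ⟨isQuasiprimitive_quotient_of_forall_le hMle hMH htop,
    M, hMuniq, n, fun _ => T, inferInstance, e, hPA, fun α => ?_⟩, hMuniq, hsub⟩
  refine not_isDiagonalAt_quotient htop hy (fun h => hx1 (funext fun j => ?_)) (i := φ.symm 0)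
    (Subtype.ext ?_) α
  · rw [← φ.apply_symm_apply j, ← hyx, h]
    rfl
  · rw [hyx, φ.apply_symm_apply, hx0]
    rfl
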